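/- All rings are commutative and Noetherian. Let $(S,\mathfrak{n})$ be a local ring. An ideal $I$ of $S$ is called a Burch ideal if $\mathfrak{n} I\neq\mathfrak{n}(I:_S\mathfrak{n})$. Let $(R,\mathfrak{m})$ be a local ring of depth $t$, with $\mathfrak{m}$-adic completion $\widehat R$. Then $R$ is called a Burch ring if there exist a maximal $\widehat R$-regular sequence $x_1,\dots,x_t$ in $\widehat R$, a regular local ring $S$ and a Burch ideal $I$ of $S$ such that $\widehat R/(x_1,\dots,x_t)\cong S/I$ as rings. **Theorem.** Let $R$ be a Burch ring of depth $t$, and let $M$ and $N$ be finitely generated $R$-modules. Assume that there exists an integer $l\ge\max\{3,t+1\}$ such that $\operatorname{Tor}_i^R(M,N)=0$ for all integers $i$ with $l+t\le i\le l+2t+1$. Then $M$ or $N$ has finite projective dimension over $R$. -/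

import Mathlib

universe u v

open CategoryTheory

/-- An ideal `I` of a local ring `(S, 𝔫)` is a *Burch ideal* if `𝔫 I ≠ 𝔫 (I : 𝔫)`. -/
def IsBurchIdeal {S : Type v} [CommRing S] [IsLocalRing S] (I : Ideal S) : Prop :=
  IsLocalRing.maximalIdeal S * I ≠
    IsLocalRing.maximalIdeal S * I.colon (IsLocalRing.maximalIdeal S : Set S)

/-- The depth of a local ring: the supremum of the lengths of the regular sequences on the ring
that are contained in the maximal ideal. -/
noncomputable def localDepth (R : Type u) [CommRing R] [IsLocalRing R] : ℕ∞ :=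
  ⨆ (xs : List R) (_ : RingTheory.Sequence.IsRegular R xs ∧ ∀ x ∈ xs, x ∈ IsLocalRing.maximalIdeal R),
    (xs.length : ℕ∞)

/-- A maximal regular sequence on a local ring `A`: a regular sequence of elements of the maximal
ideal that cannot be prolonged. -/
def IsMaximalRegularSequence (A : Type u) [CommRing A] [IsLocalRing A] (xs : List A) : Prop :=
  RingTheory.Sequence.IsRegular A xs ∧ (∀ x ∈ xs, x ∈ IsLocalRing.maximalIdeal A) ∧
    ∀ y ∈ IsLocalRing.maximalIdeal A, ¬ RingTheory.Sequence.IsRegular A (xs ++ [y])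

/-- The `𝔪`-adic completion of a local ring `(R, 𝔪)`. -/
abbrev LocalCompletion (R : Type u) [CommRing R] [IsLocalRing R] : Type u :=
  AdicCompletion (IsLocalRing.maximalIdeal R) R

/-- A noetherian local ring `(R, 𝔪)` of depth `t` is a *Burch ring* if there are a maximal regular
sequence `x₁, …, x_t` in its completion `R̂`, a regular local ring `S` and a Burch ideal `I` of `S`
such that `R̂ / (x₁, …, x_t) ≅ S / I` as rings. The ring `S` may live in any universe `v`. -/
def IsBurchRing (R : Type u) [CommRing R] [IsLocalRing R] [IsNoetherianRing R] : Prop :=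
  ∃ xs : List (LocalCompletion R),
    (xs.length : ℕ∞) = localDepth R ∧
    IsMaximalRegularSequence (LocalCompletion R) xs ∧
    ∃ (S : Type v) (_ : CommRing S) (_ : IsRegularLocalRing S) (I : Ideal S),
      IsBurchIdeal I ∧
      Nonempty ((LocalCompletion R ⧸ Ideal.ofList xs) ≃+* (S ⧸ I))

/-! Take minimal free resolutions `A` of `N` and `B` of `M`, kept as matrices over the maximal
ideal, and let them act on powers of a coefficient module `C`. If a term of either resolution is
zero, that module has finite projective dimension, so the goal is a vanishing rank. Ranks survive
the flat base change to the completion, hence nothing has to be descended.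

Over the completion, regular elements are killed one at a time (`exists_reduction`): `M` becomes its
first syzygy modulo `x`, both resolutions are shifted by one, and the window of vanishing Tor loses
one degree. After `t` elements two consecutive degrees remain.

In depth zero, choose `a ∈ (I : 𝔫)` and `x ∈ 𝔫` with `x * a ∉ 𝔫 I`. Multiplying the class of `0 → ΩM
→ F₀ → M → 0` by `x` gives an extension `E` whose Tor vanishes wherever that of `M` and `ΩM` does.
Its second syzygy is the kernel of a block matrix with `x` on a diagonal, and the socle vector `a
e_j` is a minimal generator of that kernel. So the residue field is a direct summand of the syzygy,
its Tor against `N` vanishes, and minimality of `A` forces a zero term. -/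

open scoped Pointwise TensorProduct

/-! ### Matrices acting on powers of a module -/

section MatrixAction

variable {T : Type*} [CommRing T] {ι κ : Type*} [Fintype κ]

/-- The action of a matrix with entries in `T` on vectors with entries in a `T`-module `C`. -/
def matAct (C : Type*) [AddCommGroup C] [Module T C] (A : Matrix ι κ T) : (κ → C) →ₗ[T] (ι → C) :=
  LinearMap.pi fun i => ∑ j, A i j • LinearMap.proj j

variable {C D : Type*} [AddCommGroup C] [Module T C] [AddCommGroup D] [Module T D]

@[simp]
theorem matAct_apply (A : Matrix ι κ T) (v : κ → C) (i : ι) :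
    matAct C A v i = ∑ j, A i j • v j := by
  simp [matAct]

theorem matAct_mul {μ : Type*} [Fintype ι] (A : Matrix μ ι T) (B : Matrix ι κ T) (v : κ → C) :
    matAct C (A * B) v = matAct C A (matAct C B v) := by
  ext i
  simp only [matAct_apply, Matrix.mul_apply, Finset.sum_smul, Finset.smul_sum, mul_smul]
  exact Finset.sum_comm

theorem matAct_comp (A : Matrix ι κ T) (f : C →ₗ[T] D) (v : κ → C) :
    matAct D A (f ∘ v) = f ∘ matAct C A v := by
  ext i
  simp

theorem matAct_single [DecidableEq κ] (A : Matrix ι κ T) (j : κ) (c : C) (i : ι) :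
    matAct C A (Pi.single j c) i = A i j • c := by
  rw [matAct_apply, Finset.sum_eq_single j] <;> simp +contextual

end MatrixAction

/-! ### Exactness with coefficients and long exact sequence arguments -/

section Chain

variable {T : Type*} [CommRing T] {n : ℕ → ℕ}

/-- The complex of free modules with matrices `A i` is exact in degree `i + 1` after tensoring
with `C`. -/
def ExactIn (A : ∀ i, Matrix (Fin (n i)) (Fin (n (i + 1))) T) (C : Type*) [AddCommGroup C]
    [Module T C] (i : ℕ) : Prop :=
  Function.Exact (matAct C (A (i + 1))) (matAct C (A i))

variable {A : ∀ i, Matrix (Fin (n i)) (Fin (n (i + 1))) T}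
variable {C C₁ C₂ C₃ : Type*} [AddCommGroup C] [Module T C] [AddCommGroup C₁] [Module T C₁]
  [AddCommGroup C₂] [Module T C₂] [AddCommGroup C₃] [Module T C₃]

theorem matAct_matAct (hA : ∀ i, A i * A (i + 1) = 0) (i : ℕ) (v : Fin (n (i + 1 + 1)) → C) :
    matAct C (A i) (matAct C (A (i + 1)) v) = 0 := by
  rw [← matAct_mul, hA]
  ext
  simp

theorem exactIn_of_forall (hA : ∀ i, A i * A (i + 1) = 0) {i : ℕ}
    (h : ∀ v : Fin (n (i + 1)) → C, matAct C (A i) v = 0 → ∃ w, matAct C (A (i + 1)) w = v) :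
    ExactIn A C i := by
  refine fun v => ⟨h v, ?_⟩
  rintro ⟨w, rfl⟩
  exact matAct_matAct hA i w

theorem mul_eq_zero_of_exactIn {i : ℕ} (h : ExactIn A T i) : A i * A (i + 1) = 0 := by
  ext a b
  have := congrFun ((h _).2 ⟨Pi.single b 1, rfl⟩) a
  rw [← matAct_mul, matAct_single] at this
  simpa using this

/-- Lifting of a vector along a surjection. -/
theorem exists_comp_eq {ι : Type*} {g : C₂ →ₗ[T] C₃} (hg : Function.Surjective g) (v : ι → C₃) :
    ∃ w : ι → C₂, g ∘ w = v :=
  ⟨fun i => (hg (v i)).choose, funext fun i => (hg (v i)).choose_spec⟩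

theorem exists_comp_eq_of_exact {ι : Type*} {f : C₁ →ₗ[T] C₂} {g : C₂ →ₗ[T] C₃}
    (h : Function.Exact f g) {v : ι → C₂} (hv : g ∘ v = 0) : ∃ w : ι → C₁, f ∘ w = v :=
  ⟨fun i => ((h (v i)).1 (congrFun hv i)).choose,
    funext fun i => ((h (v i)).1 (congrFun hv i)).choose_spec⟩

theorem linearMap_comp_sub (f : C →ₗ[T] C₁) {ι : Type*} (v w : ι → C) :
    f ∘ (v - w) = f ∘ v - f ∘ w := by ext; simp

theorem comp_injective {f : C →ₗ[T] C₁} (hf : Function.Injective f) {ι : Type*} {v w : ι → C}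
    (h : f ∘ v = f ∘ w) : v = w :=
  funext fun i => hf (congrFun h i)

section ShortExact

variable {f : C₁ →ₗ[T] C₂} {g : C₂ →ₗ[T] C₃}

theorem exactIn_middle {i : ℕ} (hA : ∀ i, A i * A (i + 1) = 0)
    (hf : Function.Injective f) (hfg : Function.Exact f g) (hg : Function.Surjective g)
    (h₁ : ExactIn A C₁ i) (h₃ : ExactIn A C₃ i) : ExactIn A C₂ i := by
  refine exactIn_of_forall hA fun v hv => ?_
  obtain ⟨w₃, hw₃⟩ := (h₃ (g ∘ v)).1 (by rw [matAct_comp, hv]; ext; simp)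
  obtain ⟨w, rfl⟩ := exists_comp_eq hg w₃
  obtain ⟨u, hu⟩ := exists_comp_eq_of_exact hfg (v := v - matAct C₂ (A (i + 1)) w) (by
    rw [linearMap_comp_sub, ← matAct_comp, hw₃, sub_self])
  obtain ⟨z, rfl⟩ := (h₁ u).1 (comp_injective hf (by
    rw [← matAct_comp, hu, map_sub, hv, matAct_matAct hA]; ext; simp))
  exact ⟨f ∘ z + w, by rw [map_add, matAct_comp, hu]; abel⟩

theorem exactIn_right {i : ℕ} (hA : ∀ i, A i * A (i + 1) = 0)
    (hf : Function.Injective f) (hfg : Function.Exact f g) (hg : Function.Surjective g)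
    (h₂ : ExactIn A C₂ (i + 1)) (h₁ : ExactIn A C₁ i) : ExactIn A C₃ (i + 1) := by
  refine exactIn_of_forall hA fun v hv => ?_
  obtain ⟨w, rfl⟩ := exists_comp_eq hg v
  obtain ⟨u, hu⟩ := exists_comp_eq_of_exact hfg (v := matAct C₂ (A (i + 1)) w) (by
    rw [← matAct_comp, hv])
  obtain ⟨z, rfl⟩ := (h₁ u).1 (comp_injective hf (by
    rw [← matAct_comp, hu, matAct_matAct hA]; ext; simp))
  obtain ⟨y, hy⟩ := (h₂ (w - f ∘ z)).1 (by rw [map_sub, matAct_comp, hu, sub_self])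
  refine ⟨g ∘ y, ?_⟩
  rw [matAct_comp, hy, linearMap_comp_sub]
  ext j
  simp [hfg.apply_apply_eq_zero]

theorem exactIn_left {i : ℕ} (hA : ∀ i, A i * A (i + 1) = 0)
    (hf : Function.Injective f) (hfg : Function.Exact f g) (hg : Function.Surjective g)
    (h₃ : ExactIn A C₃ (i + 1)) (h₂ : ExactIn A C₂ i) : ExactIn A C₁ i := by
  refine exactIn_of_forall hA fun v hv => ?_
  obtain ⟨w, hw⟩ := (h₂ (f ∘ v)).1 (by rw [matAct_comp, hv]; ext; simp)
  obtain ⟨u, hu⟩ := (h₃ (g ∘ w)).1 (by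
    rw [matAct_comp, hw]; ext j; simp [hfg.apply_apply_eq_zero])
  obtain ⟨u, rfl⟩ := exists_comp_eq hg u
  obtain ⟨z, hz⟩ := exists_comp_eq_of_exact hfg (v := w - matAct C₂ (A (i + 1 + 1)) u) (by
    rw [linearMap_comp_sub, ← matAct_comp, hu, sub_self])
  refine ⟨z, comp_injective hf ?_⟩
  rw [← matAct_comp, hz, map_sub, hw, matAct_matAct hA, sub_zero]

end ShortExact

theorem ExactIn.of_retract {i : ℕ} (h : ExactIn A C₂ i) (hA : ∀ i, A i * A (i + 1) = 0)
    (s : C₁ →ₗ[T] C₂) (r : C₂ →ₗ[T] C₁) (hrs : ∀ c, r (s c) = c) : ExactIn A C₁ i := by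
  refine exactIn_of_forall hA fun v hv => ?_
  obtain ⟨w, hw⟩ := (h (s ∘ v)).1 (by rw [matAct_comp, hv]; ext; simp)
  refine ⟨r ∘ w, ?_⟩
  rw [matAct_comp, hw]
  ext
  simp [hrs]

theorem ExactIn.of_equiv {i : ℕ} (h : ExactIn A C₂ i) (hA : ∀ i, A i * A (i + 1) = 0)
    (e : C₁ ≃ₗ[T] C₂) : ExactIn A C₁ i :=
  h.of_retract hA e.toLinearMap e.symm.toLinearMap (by simp)

theorem ExactIn.pi {i : ℕ} (h : ExactIn A C i) (hA : ∀ i, A i * A (i + 1) = 0) (ι : Type*) :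
    ExactIn A (ι → C) i := by
  refine exactIn_of_forall hA fun v hv => ?_
  have key : ∀ k : ι, ∃ w, matAct C (A (i + 1)) w = fun j => v j k := fun k =>
    (h _).1 (by
      ext a
      have := congrFun (congrFun hv a) k
      simpa using this)
  choose w hw using key
  refine ⟨fun j k => w k j, ?_⟩
  ext a k
  have := congrFun (hw k) a
  simpa using this

/-- If the entries act by zero on a nonzero module, exactness forces the term to vanish. -/
theorem eq_zero_of_exactIn {i : ℕ} [Nontrivial C] (h : ExactIn A C i)
    (h0 : ∀ i a b, ∀ c : C, A i a b • c = 0) : n (i + 1) = 0 := by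
  by_contra hn
  obtain ⟨c, hc⟩ := exists_ne (0 : C)
  have h1 : ∀ i v, matAct C (A i) v = 0 := fun i v => by ext a; simp [h0]
  obtain ⟨w, hw⟩ := (h fun _ => c).1 (h1 _ _)
  rw [h1] at hw
  exact hc (congrFun hw ⟨0, Nat.pos_of_ne_zero hn⟩).symm

/-- Dimension shifting along a surjection from a module on which the complex is exact. -/
theorem exactIn_ker {i : ℕ} (hA : ∀ i, A i * A (i + 1) = 0) (p : C₂ →ₗ[T] C₃)
    (hp : Function.Surjective p) (h₃ : ExactIn A C₃ (i + 1)) (h₂ : ExactIn A C₂ i) :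
    ExactIn A (LinearMap.ker p) i :=
  exactIn_left hA (Submodule.injective_subtype _) (p.exact_subtype_ker_map) hp h₃ h₂

end Chain

/-! ### Passing to the quotient by a regular element -/

section Hypersurface

variable {T : Type*} [CommRing T] {n m : ℕ → ℕ}
  {A : ∀ i, Matrix (Fin (n i)) (Fin (n (i + 1))) T}
  {B : ∀ i, Matrix (Fin (m i)) (Fin (m (i + 1))) T}

/-- Two surjections with the same kernel have isomorphic targets. -/
theorem nonempty_equiv_of_ker_eq {X Y Z : Type*} [AddCommGroup X] [Module T X] [AddCommGroup Y]
    [Module T Y] [AddCommGroup Z] [Module T Z] {f : X →ₗ[T] Y} {g : X →ₗ[T] Z}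
    (hf : Function.Surjective f) (hg : Function.Surjective g)
    (h : ∀ v, f v = 0 ↔ g v = 0) : Nonempty (Y ≃ₗ[T] Z) :=
  ⟨(f.quotKerEquivOfSurjective hf).symm ≪≫ₗ Submodule.quotEquivOfEq _ _ (by ext v; exact h v) ≪≫ₗ
    g.quotKerEquivOfSurjective hg⟩

theorem quotSMulTop_mk_eq_zero_iff {C : Type*} [AddCommGroup C] [Module T C] (x : T) (c : C) :
    Submodule.mkQ (x • (⊤ : Submodule T C)) c = 0 ↔ ∃ d, x • d = c := by
  rw [Submodule.mkQ_apply, Submodule.Quotient.mk_eq_zero,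
    Submodule.mem_smul_pointwise_iff_exists]
  simp

/-- The long exact sequence of `0 → C → C → C/xC → 0` costs one degree: two consecutive exact spots
for `C` give one for the quotient. -/
theorem exactIn_quotSMulTop {C : Type*} [AddCommGroup C] [Module T C] {x : T}
    (hA : ∀ i, A i * A (i + 1) = 0) (hx : IsSMulRegular C x) {i : ℕ}
    (h₀ : ExactIn A C i) (h₁ : ExactIn A C (i + 1)) : ExactIn A (QuotSMulTop x C) (i + 1) := by
  refine exactIn_right (f := LinearMap.lsmul T C x) (g := Submodule.mkQ (x • (⊤ : Submodule T C)))
    hA hx (fun c => ?_) (Submodule.mkQ_surjective _) h₁ h₀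
  rw [quotSMulTop_mk_eq_zero_iff]
  simp

theorem surjective_codRestrict_ker {X Y Z : Type*} [AddCommGroup X] [Module T X] [AddCommGroup Y]
    [Module T Y] [AddCommGroup Z] [Module T Z] {f : X →ₗ[T] Y} {g : Y →ₗ[T] Z}
    (h : Function.Exact f g) : Function.Surjective
      (f.codRestrict (LinearMap.ker g) fun c => h.apply_apply_eq_zero c) := by
  rintro ⟨y, hy⟩
  obtain ⟨x, rfl⟩ := (h y).1 hy
  exact ⟨x, rfl⟩

/-- Replacing two modules by their first syzygies modulo a regular element. -/
theorem exists_reduction {C M : Type*} [AddCommGroup C] [Module T C] [AddCommGroup M] [Module T M]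
    {x : T} (hA : ∀ i, A i * A (i + 1) = 0) (hx : IsSMulRegular C x) (hAC : ∀ i, ExactIn A C i)
    (hBC : ExactIn B C 0)
    {p : (Fin (m 0) → C) →ₗ[T] M} (hp : Function.Surjective p)
    (hBp : Function.Exact (matAct C (B 0)) p) {a b : ℕ}
    (h : ∀ i, a + 2 ≤ i → i ≤ b + 2 → ExactIn A M i) (i : ℕ) (hai : a + 1 ≤ i) (hib : i ≤ b) :
    ExactIn (n := fun i => n (i + 1)) (fun i => A (i + 1))
      ((Fin (m 1) → QuotSMulTop x C) ⧸ LinearMap.range (matAct (QuotSMulTop x C) (B 1))) i := by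
  have hker : ∀ j, a + 1 ≤ j → j ≤ b + 1 → ExactIn A (LinearMap.ker p) j := fun j h1 h2 =>
    exactIn_ker hA p hp (h (j + 1) (by omega) (by omega)) ((hAC j).pi hA _)
  -- No regularity on `M` is needed: the syzygy embeds in a power of `C`.
  have hreg : IsSMulRegular (LinearMap.ker p) x := fun u v huv => by
    ext k
    exact hx (congrFun (congrArg Subtype.val huv) k)
  have h3 : ExactIn A (QuotSMulTop x (LinearMap.ker p)) (i + 1) :=
    exactIn_quotSMulTop hA hreg (hker i hai (by omega)) (hker (i + 1) (by omega) (by omega))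
  have hsurj := surjective_codRestrict_ker hBp
  -- Both surjections from `C ^ m 1` have kernel `im (B 1) + x C ^ m 1`.
  obtain ⟨e⟩ := nonempty_equiv_of_ker_eq
    (f := (LinearMap.range (matAct (QuotSMulTop x C) (B 1))).mkQ ∘ₗ
      (Submodule.mkQ (x • (⊤ : Submodule T C))).compLeft (Fin (m 1)))
    (g := Submodule.mkQ (x • (⊤ : Submodule T (LinearMap.ker p))) ∘ₗ
      (matAct C (B 0)).codRestrict (LinearMap.ker p) fun c => hBp.apply_apply_eq_zero c)
    ((Submodule.mkQ_surjective _).comp (Submodule.mkQ_surjective _).comp_left)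
    ((Submodule.mkQ_surjective _).comp hsurj) (fun v => by
      rw [LinearMap.comp_apply, LinearMap.comp_apply, quotSMulTop_mk_eq_zero_iff,
        Submodule.mkQ_apply, Submodule.Quotient.mk_eq_zero]
      constructor
      · rintro ⟨z, hz⟩
        obtain ⟨z, rfl⟩ := exists_comp_eq (Submodule.mkQ_surjective _) z
        have : ∀ k, ∃ d, x • d = (v - matAct C (B 1) z) k := fun k => by
          rw [← quotSMulTop_mk_eq_zero_iff, Pi.sub_apply, map_sub, sub_eq_zero]
          rw [matAct_comp] at hz
          exact (congrFun hz k).symm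
        choose w hw using this
        have hw' : v = matAct C (B 1) z + x • w := by
          ext k
          have := hw k
          simp only [Pi.sub_apply, Pi.add_apply, Pi.smul_apply] at this ⊢
          rw [this]; abel
        refine ⟨⟨matAct C (B 0) w, hBp.apply_apply_eq_zero w⟩, Subtype.ext ?_⟩
        show x • matAct C (B 0) w = matAct C (B 0) v
        rw [hw', map_add, map_smul, hBC.apply_apply_eq_zero]
        exact (zero_add _).symm
      · rintro ⟨k, hk⟩
        obtain ⟨w, rfl⟩ := hsurj k
        have hk' : x • matAct C (B 0) w = matAct C (B 0) v := congrArg Subtype.val hk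
        obtain ⟨z, hz⟩ := (hBC (v - x • w)).1 (by rw [map_sub, map_smul, hk', sub_self])
        refine ⟨Submodule.mkQ (x • (⊤ : Submodule T C)) ∘ z, ?_⟩
        rw [matAct_comp, hz, linearMap_comp_sub]
        ext k
        have : Submodule.mkQ (x • (⊤ : Submodule T C)) (x • w k) = 0 :=
          (quotSMulTop_mk_eq_zero_iff _ _).2 ⟨_, rfl⟩
        simp only [Pi.sub_apply, Function.comp_apply, Pi.smul_apply, this, sub_zero,
          LinearMap.compLeft_apply])
  exact ExactIn.of_equiv (i := i) (A := fun i => A (i + 1)) (n := fun i => n (i + 1)) h3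
    (fun i => hA (i + 1)) e

end Hypersurface

/-! ### Burch ideals and residue field summands -/

section Burch

variable {T : Type*} [CommRing T] [IsLocalRing T]

open IsLocalRing

/-- An element annihilated by the maximal ideal `𝔪` of `T` and lying outside `𝔪 V` spans a direct
summand of `V`. -/
theorem exists_retract_residueField {V : Type*} [AddCommGroup V] [Module T V] (v : V)
    (h0 : ∀ y ∈ maximalIdeal T, y • v = 0)
    (h1 : v ∉ maximalIdeal T • (⊤ : Submodule T V)) :
    ∃ (s : (T ⧸ maximalIdeal T) →ₗ[T] V) (r : V →ₗ[T] (T ⧸ maximalIdeal T)),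
      ∀ c, r (s c) = c := by
  let K := T ⧸ maximalIdeal T
  let _ : Field K := Ideal.Quotient.field _
  let W := V ⧸ maximalIdeal T • (⊤ : Submodule T V)
  let q : W := Submodule.mkQ _ v
  have hq : q ≠ 0 := by
    intro h
    exact h1 ((Submodule.Quotient.mk_eq_zero _).1 h)
  obtain ⟨g, hg⟩ := LinearMap.exists_leftInverse_of_injective (LinearMap.toSpanSingleton K W q)
    (LinearMap.ker_toSpanSingleton K hq)
  refine ⟨Submodule.liftQ _ (LinearMap.toSpanSingleton T V v) (fun y hy => by simpa using h0 y hy),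
    (g.restrictScalars T).comp (Submodule.mkQ _), fun c => ?_⟩
  obtain ⟨c, rfl⟩ := Submodule.mkQ_surjective _ c
  have h2 : g q = 1 := by simpa using LinearMap.congr_fun hg 1
  have h3 : g (c • q) = c • g q := (g.restrictScalars T).map_smul c q
  show g (Submodule.mkQ _ (c • v)) = _
  rw [map_smul]
  refine h3.trans ?_
  rw [h2]
  exact (Algebra.algebraMap_eq_smul_one (A := K) c).symm

/-- The property of a quotient of `T` by a Burch ideal which is used below: there are a socle
element `a` of `C` and `x ∈ 𝔪` such that `a e_j` is a minimal generator of the kernel of every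
matrix over `𝔪` which has `x` as an entry in column `j`. -/
def HasBurchElement (T : Type*) [CommRing T] [IsLocalRing T] (C : Type*) [AddCommGroup C]
    [Module T C] : Prop :=
  ∃ a : C, ∃ x ∈ maximalIdeal T, (∀ y ∈ maximalIdeal T, y • a = 0) ∧
    ∀ (ι κ : Type) [Fintype κ] [DecidableEq κ] (D : Matrix ι κ T) (i : ι) (j : κ),
      (∀ i j, D i j ∈ maximalIdeal T) → D i j = x →
      ∀ v : LinearMap.ker (matAct C D), (v : κ → C) = Pi.single j a →
        v ∉ maximalIdeal T • (⊤ : Submodule T (LinearMap.ker (matAct C D)))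

theorem IsBurchIdeal.exists_mul_notMem {S : Type*} [CommRing S] [IsLocalRing S] {I : Ideal S}
    (hI : IsBurchIdeal I) : ∃ a x, (∀ y ∈ maximalIdeal S, y * a ∈ I) ∧ x ∈ maximalIdeal S ∧
      x * a ∉ maximalIdeal S * I := by
  by_contra! h
  refine hI (le_antisymm (Ideal.mul_mono_right Ideal.le_colon) (Ideal.mul_le.2 fun x hx a ha => ?_))
  refine h a x (fun y hy => ?_) hx
  rw [mul_comm]
  exact Submodule.mem_colon.1 ha y hy

/-- `S` and `T` are compared only through the common quotient `Q`. Pairing lifts to `S` of kernel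
vectors with a lifted row of `D` sends `𝔪 · ker` into `𝔫 I`, whereas `a e_j` pairs to `x * a`. -/
theorem IsBurchIdeal.hasBurchElement {S Q C : Type*} [CommRing S] [IsLocalRing S] {I : Ideal S}
    (hI : IsBurchIdeal I) [CommRing Q] [Algebra T Q] {π : S →+* Q} (hπ : Function.Surjective π)
    (hker : ∀ s, π s = 0 ↔ s ∈ I)
    (hST : ∀ s ∈ maximalIdeal S, ∃ y ∈ maximalIdeal T, algebraMap T Q y = π s)
    (hTS : ∀ y ∈ maximalIdeal T, ∃ s ∈ maximalIdeal S, π s = algebraMap T Q y)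
    [AddCommGroup C] [Module T C] (e : C ≃ₗ[T] Q) : HasBurchElement T C := by
  obtain ⟨a, x, ha, hx, hxa⟩ := hI.exists_mul_notMem
  obtain ⟨x', hx', hxx'⟩ := hST x hx
  refine ⟨e.symm (π a), x', hx', fun y hy => ?_, fun ι κ _ _ D i j hD hDij v hv hmem => ?_⟩
  · obtain ⟨s, hs, hsy⟩ := hTS y hy
    apply e.injective
    rw [map_smul, e.apply_symm_apply, map_zero, Algebra.smul_def, ← hsy, ← map_mul, hker]
    exact ha s hs
  · have hlift : ∀ k, ∃ ρ ∈ maximalIdeal S, π ρ = algebraMap T Q (D i k) ∧ (k = j → ρ = x) := by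
      intro k
      by_cases hk : k = j
      · subst hk
        exact ⟨x, hx, by rw [hDij, hxx'], fun _ => rfl⟩
      · obtain ⟨s, hs, hsy⟩ := hTS _ (hD i k)
        exact ⟨s, hs, hsy, fun h => absurd h hk⟩
    choose ρ hρ hρD hρx using hlift
    -- Quantifying over all lifts `w` is harmless: two lifts differ by entries of `I`, and the row
    -- lies in `𝔫`, so the pairing changes by an element of `𝔫 I`.
    have key : ∀ z ∈ maximalIdeal T • (⊤ : Submodule T (LinearMap.ker (matAct C D))),
        ∀ w : κ → S, (∀ k, π (w k) = e ((z : κ → C) k)) →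
          ∑ k, ρ k * w k ∈ maximalIdeal S * I := by
      intro z hz
      induction hz using Submodule.smul_induction_on' with
      | smul y hy z _ =>
        intro w hw
        obtain ⟨s, hs, hsy⟩ := hTS y hy
        choose u hu using fun k => hπ (e ((z : κ → C) k))
        have : ∑ k, ρ k * w k = ∑ k, ρ k * (w k - s * u k) + s * ∑ k, ρ k * u k := by
          rw [Finset.mul_sum, ← Finset.sum_add_distrib]
          exact Finset.sum_congr rfl fun k _ => by ring
        rw [this]
        refine add_mem (sum_mem fun k _ => Ideal.mul_mem_mul (hρ k) ?_) (Ideal.mul_mem_mul hs ?_)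
        · rw [← hker, map_sub, hw, map_mul, hu, hsy, ← Algebra.smul_def, ← map_smul]
          exact sub_self _
        · have hz := congrFun (LinearMap.mem_ker.1 z.2) i
          rw [matAct_apply, Pi.zero_apply] at hz
          rw [← hker, map_sum, ← map_zero e, ← hz, map_sum]
          exact Finset.sum_congr rfl fun k _ => by
            rw [map_mul, hρD, hu, map_smul, Algebra.smul_def]
      | add z₁ h₁ z₂ h₂ ih₁ ih₂ =>
        intro w hw
        choose u hu using fun k => hπ (e ((z₁ : κ → C) k))
        have : ∑ k, ρ k * w k = ∑ k, ρ k * u k + ∑ k, ρ k * (w k - u k) := by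
          rw [← Finset.sum_add_distrib]
          exact Finset.sum_congr rfl fun k _ => by ring
        rw [this]
        refine add_mem (ih₁ u hu) (ih₂ _ fun k => ?_)
        rw [map_sub, hw, hu]
        simp
    have := key v hmem (Pi.single j a) fun k => by
      rw [hv]
      by_cases hk : k = j
      · subst hk; simp
      · simp [hk]
    rw [Finset.sum_eq_single j (by simp +contextual) (by simp), hρx j rfl, Pi.single_eq_same] at this
    exact hxa this

end Burch

/-! ### The depth zero case -/

section DepthZero

open IsLocalRing

variable {T : Type*} [CommRing T] {n m : ℕ → ℕ}
  {A : ∀ i, Matrix (Fin (n i)) (Fin (n (i + 1))) T}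
  {B : ∀ i, Matrix (Fin (m i)) (Fin (m (i + 1))) T}

/-- Dimension shifting along a linear map `f` followed by `g`. -/
theorem exactIn_ker_of_exact {X Y Z : Type*} [AddCommGroup X] [Module T X] [AddCommGroup Y]
    [Module T Y] [AddCommGroup Z] [Module T Z] (hA : ∀ i, A i * A (i + 1) = 0)
    {f : X →ₗ[T] Y} {g : Y →ₗ[T] Z} (h : Function.Exact f g) {i : ℕ}
    (hX : ExactIn A X i) (hg : ExactIn A (LinearMap.ker g) (i + 1)) :
    ExactIn A (LinearMap.ker f) i := by
  refine (exactIn_ker hA _ (surjective_codRestrict_ker h) hg hX).of_equiv hA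
    (LinearEquiv.ofEq _ _ ?_)
  ext x
  rw [LinearMap.mem_ker, LinearMap.mem_ker, Subtype.ext_iff]
  rfl

/-- The matrix of the first syzygy of the extension of a module by its first syzygy that is
obtained by multiplying the class of the presentation by `x`. -/
def coneMatrix (B : ∀ i, Matrix (Fin (m i)) (Fin (m (i + 1))) T) (x : T) :
    Matrix (Fin (m 1) ⊕ Fin (m 0)) (Fin (m 2) ⊕ Fin (m 1)) T :=
  Matrix.fromBlocks (B 1) (x • 1) 0 (B 0)

theorem matAct_coneMatrix {C : Type*} [AddCommGroup C] [Module T C] (x : T)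
    (v : Fin (m 2) ⊕ Fin (m 1) → C) : matAct C (coneMatrix B x) v =
      Sum.elim (matAct C (B 1) (v ∘ Sum.inl) + x • (v ∘ Sum.inr))
        (matAct C (B 0) (v ∘ Sum.inr)) := by
  ext (k | k)
  · simp [coneMatrix, Matrix.one_apply]
  · simp [coneMatrix]

theorem coneMatrix_mem [IsLocalRing T] (hB : ∀ i a b, B i a b ∈ maximalIdeal T) {x : T}
    (hx : x ∈ maximalIdeal T) (a : Fin (m 1) ⊕ Fin (m 0)) (b : Fin (m 2) ⊕ Fin (m 1)) :
    coneMatrix B x a b ∈ maximalIdeal T := by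
  rcases a with a | a <;> rcases b with b | b
  · exact hB 1 a b
  · exact Ideal.mul_mem_right _ _ hx
  · exact zero_mem _
  · exact hB 0 a b


variable {C M : Type*} [AddCommGroup C] [Module T C] [AddCommGroup M] [Module T M]

theorem exactIn_ker_coneMatrix (hA : ∀ i, A i * A (i + 1) = 0) (hAC : ∀ i, ExactIn A C i)
    (hBC : ExactIn B C 0) {p : (Fin (m 0) → C) →ₗ[T] M} (hp : Function.Surjective p)
    (hBp : Function.Exact (matAct C (B 0)) p) {l : ℕ} (h₂ : ExactIn A M (l + 2))
    (h₃ : ExactIn A M (l + 3)) (x : T) :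
    ExactIn A (LinearMap.ker (matAct C (coneMatrix B x))) l := by
  -- `E` is the pullback of `p` along multiplication by `-x`, an extension of `M` by `ker p`.
  let E := LinearMap.ker (p.coprod (LinearMap.lsmul T M x))
  have hE : ∀ c : E, p c.1.1 + x • c.1.2 = 0 := fun c => c.2
  let f : LinearMap.ker p →ₗ[T] E := ((LinearMap.inl T (Fin (m 0) → C) M).comp
    (Submodule.subtype _)).codRestrict E fun c => by
      show p c + x • (0 : M) = 0
      rw [smul_zero, add_zero]
      exact c.2
  let g : E →ₗ[T] M := (LinearMap.snd T _ _).comp (Submodule.subtype _)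
  have hf : Function.Injective f := fun c d h => by
    have : (f c).1.1 = (f d).1.1 := by rw [h]
    exact Subtype.ext this
  have hg : Function.Surjective g := fun y => by
    obtain ⟨c, hc⟩ := hp (-(x • y))
    refine ⟨⟨(c, y), ?_⟩, rfl⟩
    show p c + x • y = 0
    rw [hc, neg_add_cancel]
  have hfg : Function.Exact f g := fun c => by
    constructor
    · intro h
      have h' : c.1.2 = 0 := h
      have hc := hE c
      rw [h', smul_zero, add_zero] at hc
      exact ⟨⟨c.1.1, hc⟩, Subtype.ext (Prod.ext rfl h'.symm)⟩
    · rintro ⟨d, rfl⟩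
      rfl
  have hAE : ExactIn A E (l + 2) := exactIn_middle hA hf hfg hg
    (exactIn_ker hA p hp h₃ ((hAC _).pi hA _)) h₂
  -- Horseshoe cover of `E`: `C ^ m 1` covers `ker p`, and `v ∈ C ^ m 0` lifts `p v ∈ M` to the pair
  -- `(-x v, p v)`.
  let q : (Fin (m 1) ⊕ Fin (m 0) → C) →ₗ[T] E :=
    ((matAct C (B 0) ∘ₗ LinearMap.funLeft T C Sum.inl - x • LinearMap.funLeft T C Sum.inr).prod
      (p ∘ₗ LinearMap.funLeft T C Sum.inr)).codRestrict E fun c => by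
        show p (matAct C (B 0) (c ∘ Sum.inl) - x • (c ∘ Sum.inr)) + x • p (c ∘ Sum.inr) = 0
        rw [map_sub, map_smul, hBp.apply_apply_eq_zero]
        abel
  have hq : ∀ c, (q c).1 = (matAct C (B 0) (c ∘ Sum.inl) - x • (c ∘ Sum.inr),
    p (c ∘ Sum.inr)) := fun c => rfl
  have hqs : Function.Surjective q := fun c => by
    obtain ⟨v, hv⟩ := hp c.1.2
    have hc := hE c
    rw [← hv, ← map_smul, ← map_add] at hc
    obtain ⟨u, hu⟩ := (hBp _).1 hc
    refine ⟨Sum.elim u v, Subtype.ext ?_⟩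
    rw [hq, Sum.elim_comp_inl, Sum.elim_comp_inr, hu, hv, add_sub_cancel_right]
  have hcq : Function.Exact (matAct C (coneMatrix B x)) q := fun c => by
    constructor
    · intro h
      have h' : (matAct C (B 0) (c ∘ Sum.inl) - x • (c ∘ Sum.inr), p (c ∘ Sum.inr)) = 0 := by
        rw [← hq, h]; rfl
      obtain ⟨w, hw⟩ := (hBp _).1 (congrArg Prod.snd h')
      have h'' := congrArg Prod.fst h'
      dsimp only at h''
      obtain ⟨z, hz⟩ := (hBC (c ∘ Sum.inl - x • w)).1 (by
        rw [map_sub, map_smul, hw]; exact h'')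
      refine ⟨Sum.elim z w, ?_⟩
      rw [matAct_coneMatrix, Sum.elim_comp_inl, Sum.elim_comp_inr, hw]
      refine (congrArg (fun y => Sum.elim (y + x • w) (c ∘ Sum.inr)) hz).trans ?_
      rw [sub_add_cancel, Sum.elim_comp_inl_inr]
    · rintro ⟨v, rfl⟩
      apply Subtype.ext
      rw [hq, matAct_coneMatrix, Sum.elim_comp_inl, Sum.elim_comp_inr, hBp.apply_apply_eq_zero,
        map_add, map_smul]
      refine Prod.ext ?_ rfl
      show matAct C (B 0) (matAct C (B 1) _) + _ - _ = 0
      rw [add_sub_cancel_right]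
      exact hBC.apply_apply_eq_zero _
  -- Two dimension shifts: `E` at `l + 2`, `ker q` at `l + 1`, the kernel of the block matrix at
  -- `l`.
  exact exactIn_ker_of_exact hA hcq ((hAC _).pi hA _)
    (exactIn_ker hA q hqs hAE ((hAC _).pi hA _))

/-- The depth zero case: two consecutive vanishing Tor modules. -/
theorem exists_eq_zero_of_hasBurchElement [IsLocalRing T] (hC : HasBurchElement T C)
    (hA : ∀ i, A i * A (i + 1) = 0)
    (hAm : ∀ i a b, A i a b ∈ maximalIdeal T) (hBm : ∀ i a b, B i a b ∈ maximalIdeal T)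
    (hAC : ∀ i, ExactIn A C i)
    (hBC : ExactIn B C 0) {p : (Fin (m 0) → C) →ₗ[T] M} (hp : Function.Surjective p)
    (hBp : Function.Exact (matAct C (B 0)) p) {l : ℕ} (h₂ : ExactIn A M (l + 2))
    (h₃ : ExactIn A M (l + 3)) : n (l + 1) = 0 ∨ m 1 = 0 := by
  refine or_iff_not_imp_right.2 fun hm => ?_
  obtain ⟨a, x, hx, ha, h⟩ := hC
  let j : Fin (m 1) := ⟨0, Nat.pos_of_ne_zero hm⟩
  have hmem := coneMatrix_mem hBm hx
  let v : LinearMap.ker (matAct C (coneMatrix B x)) := ⟨Pi.single (Sum.inr j) a, by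
    rw [LinearMap.mem_ker]
    ext k
    rw [matAct_single]
    exact ha _ (hmem _ _)⟩
  -- Row `inl j` and column `inr j` meet in the diagonal of the block `x • 1`, where the entry is
  -- `x`.
  obtain ⟨s, r, hrs⟩ := exists_retract_residueField v
    (fun y hy => Subtype.ext (by
      show y • Pi.single (Sum.inr j) a = (0 : Fin (m 2) ⊕ Fin (m 1) → C)
      rw [← Pi.single_smul, ha y hy, Pi.single_zero]))
    (h _ _ (coneMatrix B x) (Sum.inl j) (Sum.inr j) hmem (by simp [coneMatrix]) v rfl)
  have : Nontrivial (T ⧸ maximalIdeal T) := Ideal.Quotient.nontrivial_iff.2 Ideal.IsPrime.ne_top'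
  refine eq_zero_of_exactIn (A := A) (C := T ⧸ maximalIdeal T)
    ((exactIn_ker_coneMatrix hA hAC hBC hp hBp h₂ h₃ x).of_retract hA s r hrs) ?_
  intro i a b c
  obtain ⟨c, rfl⟩ := Ideal.Quotient.mk_surjective c
  exact Ideal.Quotient.eq_zero_iff_mem.2 (Ideal.mul_mem_right c _ (hAm i a b))

end DepthZero

/-! ### Induction on the regular sequence -/

section Induction

open IsLocalRing

universe w

theorem HasBurchElement.of_equiv {T : Type*} [CommRing T] [IsLocalRing T] {C D : Type*}
    [AddCommGroup C] [Module T C] [AddCommGroup D] [Module T D] (h : HasBurchElement T C)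
    (e : D ≃ₗ[T] C) : HasBurchElement T D := by
  obtain ⟨a, x, hx, ha, h⟩ := h
  refine ⟨e.symm a, x, hx, fun y hy => by rw [← map_smul, ha y hy, map_zero],
    fun ι κ _ _ M i j hM hMx v hv hmem => ?_⟩
  let f : LinearMap.ker (matAct D M) →ₗ[T] LinearMap.ker (matAct C M) :=
    ((e.toLinearMap.compLeft κ).comp (Submodule.subtype _)).codRestrict _ fun w => by
      refine (matAct_comp M e.toLinearMap w.1).trans ?_
      rw [LinearMap.mem_ker.1 w.2]
      ext
      simp
  refine h ι κ M i j hM hMx (f v) ?_ ?_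
  · show e ∘ v.1 = _
    rw [hv]
    ext k
    by_cases hk : k = j
    · subst hk; simp
    · simp [hk]
  · have := Submodule.mem_map_of_mem (f := f) hmem
    rw [Submodule.map_smul''] at this
    exact Submodule.smul_mono le_rfl le_top this

/-- The ring `T` stays fixed and only `C` is divided by the sequence, so the matrices never change,
apart from the index shift. The window has `xs.length + 2` degrees, leaving exactly two when the
sequence is exhausted. -/
theorem exists_eq_zero_of_isWeaklyRegular {T : Type*} [CommRing T] [IsLocalRing T] (xs : List T) :
    ∀ {n m : ℕ → ℕ} (A : ∀ i, Matrix (Fin (n i)) (Fin (n (i + 1))) T)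
      (B : ∀ i, Matrix (Fin (m i)) (Fin (m (i + 1))) T)
      (C : Type w) [AddCommGroup C] [Module T C] (M : Type w) [AddCommGroup M] [Module T M]
      (p : (Fin (m 0) → C) →ₗ[T] M) (l : ℕ),
      RingTheory.Sequence.IsWeaklyRegular C xs →
      HasBurchElement T (C ⧸ (Ideal.ofList xs • ⊤ : Submodule T C)) →
      (∀ i, A i * A (i + 1) = 0) → (∀ i, B i * B (i + 1) = 0) →
      (∀ i a b, A i a b ∈ maximalIdeal T) → (∀ i a b, B i a b ∈ maximalIdeal T) →
      (∀ i, ExactIn A C i) → (∀ i, ExactIn B C i) →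
      Function.Surjective p → Function.Exact (matAct C (B 0)) p →
      (∀ i, l + 2 + xs.length ≤ i → i ≤ l + 2 + 2 * xs.length + 1 → ExactIn A M i) →
      ∃ i, n i = 0 ∨ m i = 0 := by
  induction xs with
  | nil =>
    intro n m A B C _ _ M _ _ p l _ hC hA hB hAm hBm hAC hBC hp hBp h
    let e : (C ⧸ (Ideal.ofList ([] : List T) • ⊤ : Submodule T C)) ≃ₗ[T] C :=
      Submodule.quotEquivOfEqBot _ (by rw [Ideal.ofList_nil]; exact Submodule.bot_smul (⊤ : Submodule T C))
    have hcomp : Function.Exact (matAct _ (B 0)) (p ∘ₗ e.toLinearMap.compLeft (Fin (m 0))) := by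
      intro v
      rw [LinearMap.comp_apply, hBp]
      constructor
      · rintro ⟨w, hw⟩
        refine ⟨e.symm ∘ w, ?_⟩
        refine (matAct_comp (B 0) e.symm.toLinearMap w).trans ?_
        rw [hw]
        ext k
        simp
      · rintro ⟨w, rfl⟩
        exact ⟨e ∘ w, matAct_comp (B 0) e.toLinearMap w⟩
    have hsurj : Function.Surjective (p ∘ₗ e.toLinearMap.compLeft (Fin (m 0))) :=
      hp.comp e.surjective.comp_left
    rcases exists_eq_zero_of_hasBurchElement hC hA hAm hBm (fun i => (hAC i).of_equiv hA e)
      ((hBC 0).of_equiv hB e) hsurj hcomp (h (l + 2) (by simp) (by simp))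
      (h (l + 3) (by simp) (by simp)) with h0 | h0
    exacts [⟨_, Or.inl h0⟩, ⟨_, Or.inr h0⟩]
  | cons x xs ih =>
    intro n m A B C _ _ M _ _ p l hreg hC hA hB hAm hBm hAC hBC hp hBp h
    rw [RingTheory.Sequence.isWeaklyRegular_cons_iff] at hreg
    obtain ⟨i, hi⟩ := @ih (fun i => n (i + 1)) (fun i => m (i + 1)) (fun i => A (i + 1))
      (fun i => B (i + 1)) (QuotSMulTop x C) _ _
      ((Fin (m 1) → QuotSMulTop x C) ⧸ LinearMap.range (matAct (QuotSMulTop x C) (B 1))) _ _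
      (Submodule.mkQ _) l hreg.2
      (hC.of_equiv (Submodule.quotOfListConsSMulTopEquivQuotSMulTopInner C x xs).symm)
      (fun i => hA (i + 1)) (fun i => hB (i + 1)) (fun i => hAm (i + 1)) (fun i => hBm (i + 1))
      (fun i => exactIn_quotSMulTop hA hreg.1 (hAC i) (hAC (i + 1)))
      (fun i => exactIn_quotSMulTop hB hreg.1 (hBC i) (hBC (i + 1)))
      (Submodule.mkQ_surjective _) (LinearMap.exact_map_mkQ_range _)
      (fun i h1 h2 => exists_reduction (a := l + 1 + xs.length) (b := l + 2 + 2 * xs.length + 1)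
        hA hreg.1 hAC (hBC 0) hp hBp (fun j h3 h4 => h j (by simp; omega) (by simp; omega)) i
        (by omega) (by omega))
    exact ⟨i + 1, hi⟩

end Induction

/-! ### Flat base change -/

section BaseChange

variable {R : Type*} [CommRing R] {n : ℕ → ℕ}
  {A : ∀ i, Matrix (Fin (n i)) (Fin (n (i + 1))) R}

theorem piRight_lTensor_matAct {ι κ : Type*} [Fintype κ] [Fintype ι] [DecidableEq κ]
    [DecidableEq ι] (V C : Type*) [AddCommGroup V] [Module R V] [AddCommGroup C] [Module R C]
    (M : Matrix ι κ R) :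
    matAct (V ⊗[R] C) M ∘ₗ (TensorProduct.piRight R R V fun _ : κ => C).toLinearMap =
      (TensorProduct.piRight R R V fun _ : ι => C).toLinearMap ∘ₗ (matAct C M).lTensor V := by
  refine TensorProduct.ext' fun v c => ?_
  ext i
  simp [TensorProduct.tmul_sum]

/-- Tensoring the complex and then evaluating, or tensoring the coefficient module. -/
theorem exactIn_tensor_iff (V C : Type*) [AddCommGroup V] [Module R V] [AddCommGroup C]
    [Module R C] (i : ℕ) : ExactIn A (V ⊗[R] C) i ↔
      Function.Exact ((matAct C (A (i + 1))).lTensor V) ((matAct C (A i)).lTensor V) :=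
  Function.Exact.iff_of_ladder_linearEquiv (piRight_lTensor_matAct V C (A (i + 1)))
    (piRight_lTensor_matAct V C (A i))

theorem ExactIn.tensor {C : Type*} [AddCommGroup C] [Module R C] {i : ℕ} (h : ExactIn A C i)
    (V : Type*) [AddCommGroup V] [Module R V] [Module.Flat R V] : ExactIn A (V ⊗[R] C) i :=
  (exactIn_tensor_iff V C i).2 (Module.Flat.lTensor_exact V h)

variable (T : Type*) [CommRing T] [Algebra R T]

theorem matAct_map {ι κ : Type*} [Fintype κ] (C : Type*) [AddCommGroup C] [Module R C] [Module T C]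
    [IsScalarTower R T C] (M : Matrix ι κ R) :
    ⇑(matAct C (M.map (algebraMap R T))) = ⇑(matAct C M) := by
  ext v i
  simp

theorem exactIn_map_iff (C : Type*) [AddCommGroup C] [Module R C] [Module T C]
    [IsScalarTower R T C] (i : ℕ) :
    ExactIn (fun i => (A i).map (algebraMap R T)) C i ↔ ExactIn A C i := by
  unfold ExactIn
  rw [matAct_map, matAct_map]

theorem ExactIn.baseChange {C : Type*} [AddCommGroup C] [Module R C] [Module.Flat R T] {i : ℕ}
    (h : ExactIn A C i) : ExactIn (fun i => (A i).map (algebraMap R T)) (T ⊗[R] C) i :=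
  (exactIn_map_iff T _ i).2 (h.tensor T)

theorem ExactIn.map_self [Module.Flat R T] (hA : ∀ i, A i * A (i + 1) = 0) {i : ℕ}
    (h : ExactIn A R i) : ExactIn (fun i => (A i).map (algebraMap R T)) T i :=
  (exactIn_map_iff T _ i).2 ((h.tensor T).of_equiv hA (TensorProduct.rid R T).symm)

theorem map_mul_map_eq_zero (hA : ∀ i, A i * A (i + 1) = 0) (i : ℕ) :
    (A i).map (algebraMap R T) * (A (i + 1)).map (algebraMap R T) = 0 := by
  rw [← Matrix.map_mul, hA, Matrix.map_zero _ (map_zero _)]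

theorem exists_presentation_baseChange {M : Type*} [AddCommGroup M] [Module R M] {a b : ℕ}
    {B : Matrix (Fin a) (Fin b) R} {p : (Fin a → R) →ₗ[R] M} (hp : Function.Surjective p)
    (h : Function.Exact (matAct R B) p) :
    ∃ q : (Fin a → T) →ₗ[T] T ⊗[R] M, Function.Surjective q ∧
      Function.Exact (matAct T (B.map (algebraMap R T))) q := by
  let e := fun k : ℕ => TensorProduct.piScalarRight R T T (Fin k)
  have he : ∀ v, matAct T (B.map (algebraMap R T)) (e b v) =
      e a ((matAct R B).lTensor T v) := by
    intro v
    induction v using TensorProduct.induction_on with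
    | zero => simp
    | tmul t w =>
      ext i
      simp [e, Algebra.smul_def, Finset.mul_sum, mul_comm, mul_left_comm]
    | add v w hv hw => simp only [map_add, hv, hw]
  refine ⟨p.baseChange T ∘ₗ (e a).symm.toLinearMap,
    (p.lTensor_surjective T hp).comp (e a).symm.surjective, fun v => ?_⟩
  refine (lTensor_exact T h hp ((e a).symm v)).trans ⟨?_, ?_⟩
  · rintro ⟨w, hw⟩
    exact ⟨e b w, by rw [he, hw, LinearEquiv.apply_symm_apply]⟩
  · rintro ⟨w, rfl⟩
    refine ⟨(e b).symm w, ?_⟩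
    rw [LinearEquiv.eq_symm_apply, ← he, LinearEquiv.apply_symm_apply]

end BaseChange

/-! ### Minimal free resolutions -/

section MinimalResolution

open IsLocalRing

variable {R : Type*} [CommRing R] [IsLocalRing R]

/-- Nakayama: lift a basis of `N / 𝔪 N`; a relation among the lifts reduces to a linear relation
among basis vectors, so its coefficients lie in `𝔪`. -/
theorem exists_minimal_cover (N : Type*) [AddCommGroup N] [Module R N] [Module.Finite R N] :
    ∃ (k : ℕ) (f : (Fin k → R) →ₗ[R] N), Function.Surjective f ∧
      ∀ v ∈ LinearMap.ker f, ∀ j, v j ∈ maximalIdeal R := by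
  let b := Module.finBasis (ResidueField R) (ResidueField R ⊗[R] N)
  choose g hg using fun i => TensorProduct.mk_surjective R N (ResidueField R)
    (residue_surjective (R := R)) (b i)
  refine ⟨_, Fintype.linearCombination R g, ?_, fun v hv j => ?_⟩
  · rw [← LinearMap.range_eq_top, Fintype.range_linearCombination]
    exact span_eq_top_of_tmul_eq_basis g b hg
  · have h1 : ∑ i, residue R (v i) • b i = 0 := by
      have := congrArg (TensorProduct.mk R (ResidueField R) N 1) (LinearMap.mem_ker.1 hv)
      rw [Fintype.linearCombination_apply, map_sum, map_zero] at this
      rw [← this]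
      refine Finset.sum_congr rfl fun i _ => ?_
      rw [map_smul, hg]
      exact algebraMap_smul (ResidueField R) (v i) (b i)
    exact (residue_eq_zero_iff _).1 (Fintype.linearIndependent_iff.1 b.linearIndependent _ h1 j)

theorem exists_minimal_matrix [IsNoetherianRing R] {a : ℕ} (K : Submodule R (Fin a → R)) :
    ∃ (k : ℕ) (M : Matrix (Fin a) (Fin k) R), LinearMap.range (matAct R M) = K ∧
      ∀ v ∈ LinearMap.ker (matAct R M), ∀ j, v j ∈ maximalIdeal R := by
  obtain ⟨k, f, hf, hk⟩ := exists_minimal_cover (R := R) K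
  let M : Matrix (Fin a) (Fin k) R := Matrix.of fun i j => (f (Pi.single j 1)).1 i
  have h : matAct R M = K.subtype ∘ₗ f := by
    refine LinearMap.pi_ext' fun j => LinearMap.ext_ring ?_
    ext i
    refine (matAct_single M j 1 i).trans ?_
    simp [M]
  refine ⟨k, M, ?_, fun v hv => hk v ?_⟩
  · rw [h, LinearMap.range_comp, LinearMap.range_eq_top.2 hf, Submodule.map_top,
      Submodule.range_subtype]
  · rw [h] at hv
    exact LinearMap.mem_ker.2 (Subtype.ext hv)

/-- Finitely generated modules over a noetherian local ring have minimal free resolutions. -/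
theorem exists_minimal_resolution [IsNoetherianRing R] (N : Type*) [AddCommGroup N] [Module R N]
    [Module.Finite R N] :
    ∃ (n : ℕ → ℕ) (A : ∀ i, Matrix (Fin (n i)) (Fin (n (i + 1))) R) (p : (Fin (n 0) → R) →ₗ[R] N),
      Function.Surjective p ∧ Function.Exact (matAct R (A 0)) p ∧ (∀ i, ExactIn A R i) ∧
        ∀ i a b, A i a b ∈ maximalIdeal R := by
  obtain ⟨k, p, hp, hpk⟩ := exists_minimal_cover (R := R) N
  choose K M hM hMk using fun s : Σ a : ℕ, Submodule R (Fin a → R) => exists_minimal_matrix s.2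
  -- The state at stage `i` is the rank of the current free module together with the submodule of it
  -- to be covered next.
  let st : ℕ → Σ a : ℕ, Submodule R (Fin a → R) := fun i =>
    Nat.rec ⟨k, LinearMap.ker p⟩ (fun _ s => ⟨K s, LinearMap.ker (matAct R (M s))⟩) i
  have hst : ∀ i, ∀ v ∈ (st i).2, ∀ j, v j ∈ maximalIdeal R := by
    intro i
    cases i with
    | zero => exact hpk
    | succ i => exact hMk (st i)
  refine ⟨fun i => (st i).1, fun i => M (st i), p, hp, ?_, fun i => ?_, fun i a b => ?_⟩
  · exact LinearMap.exact_iff.2 (hM (st 0)).symm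
  · exact LinearMap.exact_iff.2 (hM (st (i + 1))).symm
  · have := hst i (matAct R (M (st i)) (Pi.single b 1)) (by
      rw [← hM (st i)]
      exact ⟨_, rfl⟩) a
    rwa [matAct_single, smul_eq_mul, mul_one] at this

end MinimalResolution

/-! ### Comparison with `Tor` and projective dimension -/

section Category

universe w

variable {R : Type w} [CommRing R] {n : ℕ → ℕ}

/-- The shifted complex resolves `ker p`, and `0 → ker p → F₀ → N → 0` raises the bound by one. -/
theorem hasProjectiveDimensionLT_of_eq_zero (i : ℕ) :
    ∀ {n : ℕ → ℕ} (A : ∀ i, Matrix (Fin (n i)) (Fin (n (i + 1))) R) (N : Type w) [AddCommGroup N]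
      [Module R N] (p : (Fin (n 0) → R) →ₗ[R] N), Function.Surjective p →
      Function.Exact (matAct R (A 0)) p → (∀ i, ExactIn A R i) → n i = 0 →
      HasProjectiveDimensionLT (ModuleCat.of R N) i := by
  induction i with
  | zero =>
    intro n A N _ _ p hp _ _ h
    have : IsEmpty (Fin (n 0)) := by rw [h]; infer_instance
    have := hp.subsingleton
    exact (hasProjectiveDimensionLT_zero_iff_isZero _).2 (ModuleCat.isZero_of_subsingleton _)
  | succ i ih =>
    intro n A N _ _ p hp h0 hA h
    have h1 : HasProjectiveDimensionLT (ModuleCat.of R (LinearMap.ker p)) i :=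
      @ih (fun i => n (i + 1)) (fun i => A (i + 1)) (LinearMap.ker p) _ _
        ((matAct R (A 0)).codRestrict (LinearMap.ker p) fun c => h0.apply_apply_eq_zero c)
        (surjective_codRestrict_ker h0)
        (fun v => by rw [← hA 0 v, Subtype.ext_iff]; rfl) (fun i => hA (i + 1)) h
    let S : ShortComplex (ModuleCat R) :=
      ShortComplex.mk (ModuleCat.ofHom (LinearMap.ker p).subtype) (ModuleCat.ofHom p) (by
        ext x
        exact x.2)
    have hS : S.ShortExact := ModuleCat.shortComplex_shortExact S p.exact_subtype_ker_map
      (Submodule.injective_subtype _) hp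
    have h2 : Projective S.X₂ :=
      (IsProjective.iff_projective (R := R) (Fin (n 0) → R)).1 inferInstance
    exact hS.hasProjectiveDimensionLT_X₃ i h1 (hasProjectiveDimensionLT_of_ge _ 1 _ (by omega))

variable (A : ∀ i, Matrix (Fin (n i)) (Fin (n (i + 1))) R)

/-- The chain complex of free modules with the given matrices. -/
noncomputable def matrixComplex (hA : ∀ i, A i * A (i + 1) = 0) : ChainComplex (ModuleCat.{w} R) ℕ :=
  ChainComplex.of (fun i => ModuleCat.of R (Fin (n i) → R)) (fun i => ModuleCat.ofHom (matAct R (A i)))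
    fun i => by
      ext1
      exact LinearMap.ext fun v => matAct_matAct hA i v

theorem matrixComplex_d (hA : ∀ i, A i * A (i + 1) = 0) (i : ℕ) :
    (matrixComplex A hA).d (i + 1) i = ModuleCat.ofHom (matAct R (A i)) :=
  ChainComplex.of_d (fun i => ModuleCat.of R (Fin (n i) → R))
    (fun i => ModuleCat.ofHom (matAct R (A i))) i

variable {A} {N : Type w} [AddCommGroup N] [Module R N]

/-- The augmentation of the chain complex of a presentation. -/
noncomputable def matrixAugmentation (hA : ∀ i, A i * A (i + 1) = 0)
    (p : (Fin (n 0) → R) →ₗ[R] N) : (matrixComplex A hA).X 0 ⟶ ModuleCat.of R N :=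
  ModuleCat.ofHom p

theorem quasiIso_toSingle₀Equiv_symm {K : ChainComplex (ModuleCat.{w} R) ℕ} {X : ModuleCat.{w} R}
    (f : K.X 0 ⟶ X) (hf : K.d 1 0 ≫ f = 0) (h0 : Function.Exact (K.d 1 0) f) (hepi : Epi f)
    (h : ∀ i, Function.Exact (K.d (i + 1 + 1) (i + 1)) (K.d (i + 1) i)) :
    QuasiIso ((K.toSingle₀Equiv X).symm ⟨f, hf⟩) where
  quasiIsoAt i := by
    cases i with
    | zero =>
      rw [ChainComplex.quasiIsoAt₀_iff, ShortComplex.quasiIso_iff_of_zeros' _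
        (K.shape 0 0 (by simp)) rfl rfl]
      have hf0 := ChainComplex.toSingle₀Equiv_symm_apply_f_zero f hf
      constructor
      · rw [ShortComplex.ShortExact.moduleCat_exact_iff_function_exact]
        have h0' : Function.Exact (K.d 1 0) (((K.toSingle₀Equiv X).symm ⟨f, hf⟩).f 0) := by
          rw [hf0]
          exact h0
        exact h0'
      · have hepi' : Epi (((K.toSingle₀Equiv X).symm ⟨f, hf⟩).f 0) := by
          rw [hf0]
          exact hepi
        exact hepi'
    | succ i =>
      rw [quasiIsoAt_iff_exactAt' (hL := ChainComplex.exactAt_succ_single_obj ..),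
        HomologicalComplex.exactAt_iff' _ (i + 2) (i + 1) i (by simp) (by simp),
        ShortComplex.ShortExact.moduleCat_exact_iff_function_exact]
      exact h i

/-- The projective resolution given by an exact complex of finite free modules. -/
noncomputable def matrixResolution (hA : ∀ i, A i * A (i + 1) = 0) (hAR : ∀ i, ExactIn A R i)
    {p : (Fin (n 0) → R) →ₗ[R] N} (hp : Function.Surjective p)
    (h : Function.Exact (matAct R (A 0)) p) : ProjectiveResolution (ModuleCat.of R N) where
  complex := matrixComplex A hA
  projective i := (IsProjective.iff_projective (R := R) (Fin (n i) → R)).1 inferInstance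
  π := ((matrixComplex A hA).toSingle₀Equiv _).symm ⟨matrixAugmentation hA p, by
    rw [matrixComplex_d]
    ext1
    exact LinearMap.ext fun v => h.apply_apply_eq_zero v⟩
  quasiIso := by
    refine quasiIso_toSingle₀Equiv_symm _ _ ?_ ((ModuleCat.epi_iff_surjective _).2 hp) fun i => ?_
    · rw [matrixComplex_d]
      exact h
    · rw [matrixComplex_d, matrixComplex_d]
      exact hAR i

/-- The index drops by one because `A i` is the differential from degree `i + 1` to degree `i`. -/
theorem exactIn_of_isZero_tor (hA : ∀ i, A i * A (i + 1) = 0) (hAR : ∀ i, ExactIn A R i)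
    {p : (Fin (n 0) → R) →ₗ[R] N} (hp : Function.Surjective p)
    (h : Function.Exact (matAct R (A 0)) p) (M : Type w) [AddCommGroup M] [Module R M] {i : ℕ}
    (hT : Limits.IsZero (((Tor (ModuleCat.{w} R) (i + 1)).obj (ModuleCat.of R M)).obj
      (ModuleCat.of R N))) : ExactIn A M i := by
  let F := (MonoidalCategory.tensoringLeft (ModuleCat.{w} R)).obj (ModuleCat.of R M)
  let P := matrixResolution hA hAR hp h
  have h1 := hT.of_iso (P.isoLeftDerivedObj F (i + 1)).symm
  have h2 : ((F.mapHomologicalComplex _).obj P.complex).ExactAt (i + 1) :=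
    (HomologicalComplex.exactAt_iff_isZero_homology _ _).2 h1
  rw [HomologicalComplex.exactAt_iff' _ (i + 2) (i + 1) i (by simp) (by simp),
    ShortComplex.ShortExact.moduleCat_exact_iff_function_exact] at h2
  refine ExactIn.of_equiv ((exactIn_tensor_iff M R i).2 ?_) hA (TensorProduct.rid R M).symm
  change Function.Exact (F.map ((matrixComplex A hA).d (i + 1 + 1) (i + 1)))
    (F.map ((matrixComplex A hA).d (i + 1) i)) at h2
  rw [matrixComplex_d, matrixComplex_d] at h2
  exact h2

end Category

/-! ### Assembly -/

section Main

open IsLocalRing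

theorem IsBurchIdeal.ne_top {S : Type*} [CommRing S] [IsLocalRing S] {I : Ideal S}
    (hI : IsBurchIdeal I) : I ≠ ⊤ := by
  rintro rfl
  refine hI ?_
  rw [Submodule.colon_eq_top_iff_subset _ |>.2]
  exact Set.subset_univ _

/-- A quotient of a local ring which is also the quotient of a local ring by a Burch ideal. -/
theorem hasBurchElement_of_ringEquiv {T S : Type*} [CommRing T] [IsLocalRing T] [CommRing S]
    [IsLocalRing S] {J : Ideal T} {I : Ideal S} (hI : IsBurchIdeal I) (e : (T ⧸ J) ≃+* (S ⧸ I)) :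
    HasBurchElement T (T ⧸ J) := by
  have := Ideal.Quotient.nontrivial_iff.2 hI.ne_top
  have : Nontrivial (T ⧸ J) := e.toEquiv.nontrivial
  let π : S →+* T ⧸ J := e.symm.toRingHom.comp (Ideal.Quotient.mk I)
  have hπ : Function.Surjective π := e.symm.surjective.comp Ideal.Quotient.mk_surjective
  have hT : Function.Surjective (algebraMap T (T ⧸ J)) := Ideal.Quotient.mk_surjective
  have := IsLocalHom.of_surjective π hπ
  have := IsLocalHom.of_surjective (algebraMap T (T ⧸ J)) hT
  refine hI.hasBurchElement (Q := T ⧸ J) hπ (fun s => ?_) (fun s hs => ?_) (fun y hy => ?_)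
    (LinearEquiv.refl T _)
  · show e.symm _ = 0 ↔ _
    rw [map_eq_zero_iff _ e.symm.injective, Ideal.Quotient.eq_zero_iff_mem]
  · obtain ⟨y, hy⟩ := hT (π s)
    refine ⟨y, fun h => hs ?_, hy⟩
    exact isUnit_of_map_unit π s (hy ▸ h.map (algebraMap T (T ⧸ J)))
  · obtain ⟨s, hs⟩ := hπ (algebraMap T (T ⧸ J) y)
    refine ⟨s, fun h => hy ?_, hs⟩
    exact isUnit_of_map_unit (algebraMap T (T ⧸ J)) y (hs ▸ h.map π)

theorem mainTheorem4 (R : Type u) [CommRing R] [IsLocalRing R] [IsNoetherianRing R]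
    (hR : IsBurchRing.{u, v} R) (t : ℕ) (ht : localDepth R = t)
    (M N : Type u) [AddCommGroup M] [Module R M] [Module.Finite R M]
    [AddCommGroup N] [Module R N] [Module.Finite R N]
    (hTor : ∃ l : ℕ, max 3 (t + 1) ≤ l ∧ ∀ i : ℕ, l + t ≤ i → i ≤ l + 2 * t + 1 →
      Limits.IsZero (((Tor (ModuleCat.{u} R) i).obj (ModuleCat.of R M)).obj (ModuleCat.of R N))) :
    projectiveDimension (ModuleCat.of R M) ≠ ⊤ ∨
      projectiveDimension (ModuleCat.of R N) ≠ ⊤ := by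
  obtain ⟨xs, hlen, ⟨hreg, -, -⟩, S, _, _, I, hI, ⟨e⟩⟩ := hR
  obtain ⟨l, hl, hTor⟩ := hTor
  rw [ht, Nat.cast_inj] at hlen
  obtain ⟨n, A, p, hp, hAp, hAR, hAm⟩ := exists_minimal_resolution (R := R) N
  obtain ⟨m, B, q, hq, hBq, hBR, hBm⟩ := exists_minimal_resolution (R := R) M
  have hA := fun i => mul_eq_zero_of_exactIn (hAR i)
  have hB := fun i => mul_eq_zero_of_exactIn (hBR i)
  let T := LocalCompletion R
  have hmem : ∀ y ∈ maximalIdeal R, algebraMap R T y ∈ maximalIdeal T := fun y hy => by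
    rw [AdicCompletion.maximalIdeal_eq_map]
    exact Ideal.mem_map_of_mem _ hy
  obtain ⟨q', hq', hBq'⟩ := exists_presentation_baseChange T hq hBq
  have hBurch : HasBurchElement T (T ⧸ (Ideal.ofList xs • ⊤ : Submodule T T)) :=
    (hasBurchElement_of_ringEquiv hI e).of_equiv
      (Submodule.quotEquivOfEq _ _ (by rw [smul_eq_mul, Ideal.mul_top]))
  -- The shift by 3 adds the `+ 2` in the lower end of the window to the step from exactness at `i`
  -- to Tor in degree `i + 1`; `l ≥ 3` makes the subtraction honest.
  obtain ⟨i, hi⟩ := exists_eq_zero_of_isWeaklyRegular xs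
    (fun i => (A i).map (algebraMap R T)) (fun i => (B i).map (algebraMap R T)) T (T ⊗[R] M) q'
    (l - 3) hreg.toIsWeaklyRegular hBurch (map_mul_map_eq_zero T hA) (map_mul_map_eq_zero T hB)
    (fun i a b => hmem _ (hAm i a b)) (fun i a b => hmem _ (hBm i a b))
    (fun i => (hAR i).map_self T hA) (fun i => (hBR i).map_self T hB) hq' hBq'
    (fun i h1 h2 => ExactIn.baseChange T (exactIn_of_isZero_tor hA hAR hp hAp M
      (hTor (i + 1) (by omega) (by omega))))
  rw [projectiveDimension_ne_top_iff, projectiveDimension_ne_top_iff]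
  rcases hi with hi | hi
  · have := hasProjectiveDimensionLT_of_eq_zero i A N p hp hAp hAR hi
    exact Or.inr ⟨i, hasProjectiveDimensionLT_of_ge _ i _ (by omega)⟩
  · have := hasProjectiveDimensionLT_of_eq_zero i B M q hq hBq hBR hi
    exact Or.inl ⟨i, hasProjectiveDimensionLT_of_ge _ i _ (by omega)⟩

end Main
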